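/- Let $\mathsf k$ be a field of characteristic zero, let $R=\mathsf k[x,y]$ act on $\mathsf k[X,Y]$ by differentiation ($x$ acts as $\partial/\partial X$ and $y$ as $\partial/\partial Y$; write $f\circ G$ for the action of $f\in R$ on $G$), let $d,k\ge 1$ be integers and put $j=2d+k-3$. Let $F\in\mathsf k[X,Y]$ be a form of degree $j$ such that the graded Artinian algebra $A=R/\operatorname{Ann}F$, where $\operatorname{Ann}F=\{f\in R: f\circ F=0\}$ (which is then a complete intersection), has Hilbert function $$T=(1,2,\ldots,d-1,\underbrace{d,\ldots,d}_{k},d-1,\ldots,2,1),$$ that is, $\dim_{\mathsf k}A_u=\min(u+1,\,d,\,j+1-u)$ for $0\le u\le j$, and $A_u=0$ for $u>j$. Let $\ell=ax+by\in R$ with $(a,b)\neq(0,0)$ and let $P_\ell=(p_1,p_2,\ldots)$, $p_1\ge p_2\ge\cdots$, be the Jordan type of $\ell$, i.e. the partition of $\dim_{\mathsf k}A$ given by the sizes of the Jordan blocks of the nilpotent multiplication map $A\to A$, $h\mapsto \ell h$ (with $p_n=0$ for $n$ larger than the number of parts). For $0\le i\le d-1$ and a basis $\alpha_0,\ldots,\alpha_i$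 of $A_i$, let $h^i_\ell(F)=\det\big[\alpha_u\alpha_v\circ F\big]_{0\le u,v\le i}$, evaluated at $(X,Y)=(a,b)$; up to a non-zero constant factor it does not depend on the basis. Then for every $i\in[0,d-1]$ and every choice of the basis of $A_i$, $$h^i_\ell(F)\neq 0\iff p_1+p_2+\cdots+p_{i+1}=(i+1)(j+1-i).$$ Moreover, $P_\ell$ has exactly $d$ parts unless $k\ge 2$ and $h^{d-1}_\ell(F)=0$, and in that exceptional case the number of parts of $P_\ell$ is not $d$. -/

import Mathlib

noncomputable section

namespace CIJordan

open MvPolynomial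

variable {K : Type*} [Field K]

/-- The partial derivative with respect to the `i`-th variable, as a `K`-linear operator on the
polynomial ring `K[X, Y]`. -/
def partialD (K : Type*) [Field K] (i : Fin 2) : Module.End K (MvPolynomial (Fin 2) K) :=
  (pderiv i).toLinearMap

/-- The action of `R = K[x, y]` on `K[X, Y]` by differentiation: the monomial `x ^ m 0 * y ^ m 1`
acts as `(∂/∂X) ^ m 0 (∂/∂Y) ^ m 1`, extended linearly.  `diffAct f F` is `f ∘ F`. -/
def diffAct : MvPolynomial (Fin 2) K →ₗ[K] Module.End K (MvPolynomial (Fin 2) K) :=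
  (basisMonomials (Fin 2) K).constr K fun m => partialD K 0 ^ m 0 * partialD K 1 ^ m 1

theorem diffAct_monomial (m : Fin 2 →₀ ℕ) (c : K) :
    diffAct (monomial m c) = c • (partialD K 0 ^ m 0 * partialD K 1 ^ m 1) := by
  have h : (monomial m c : MvPolynomial (Fin 2) K) = c • basisMonomials (Fin 2) K m := by
    simp [smul_monomial]
  rw [h, map_smul, diffAct, Module.Basis.constr_basis]

theorem partialD_commute (i j : Fin 2) : Commute (partialD K i) (partialD K j) := by
  have h : ⁅(pderiv i : Derivation K (MvPolynomial (Fin 2) K) (MvPolynomial (Fin 2) K)),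
      (pderiv j : Derivation K (MvPolynomial (Fin 2) K) (MvPolynomial (Fin 2) K))⁆ = 0 := by
    apply derivation_ext
    intro l
    simp only [Derivation.commutator_apply, pderiv_X, Derivation.zero_apply]
    simp only [Pi.single_apply]
    split_ifs <;> simp
  refine LinearMap.ext fun G => ?_
  have hG := congrArg (fun D => D G) h
  simp only [Derivation.commutator_apply, Derivation.zero_apply] at hG
  exact sub_eq_zero.mp hG

theorem diffAct_mul (f g : MvPolynomial (Fin 2) K) :
    diffAct (f * g) = diffAct f * diffAct g := by
  induction f using MvPolynomial.induction_on' with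
  | add p q hp hq => rw [add_mul, map_add, map_add, hp, hq, add_mul]
  | monomial m c =>
    induction g using MvPolynomial.induction_on' with
    | add p q hp hq => rw [mul_add, map_add, map_add, hp, hq, mul_add]
    | monomial n e =>
      rw [monomial_mul, diffAct_monomial, diffAct_monomial, diffAct_monomial,
        smul_mul_smul_comm, Finsupp.add_apply, Finsupp.add_apply, pow_add, pow_add]
      congr 1
      have hc : Commute (partialD K 0 ^ n 0) (partialD K 1 ^ m 1) :=
        (partialD_commute 0 1).pow_pow _ _
      rw [mul_assoc, mul_assoc, ← mul_assoc (partialD K 0 ^ n 0), hc.eq, mul_assoc]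

/-- The annihilator `Ann F = {f ∈ R | f ∘ F = 0}`, an ideal of `R = K[x, y]`. -/
def annF (F : MvPolynomial (Fin 2) K) : Ideal (MvPolynomial (Fin 2) K) where
  carrier := {f | diffAct f F = 0}
  add_mem' := by
    intro a b ha hb
    simp only [Set.mem_ofPred_eq] at ha hb ⊢
    rw [map_add, LinearMap.add_apply, ha, hb, add_zero]
  zero_mem' := by simp
  smul_mem' := by
    intro c f hf
    simp only [Set.mem_ofPred_eq] at hf ⊢
    rw [smul_eq_mul, diffAct_mul, Module.End.mul_apply, hf, map_zero]

theorem mem_annF {F f : MvPolynomial (Fin 2) K} : f ∈ annF F ↔ diffAct f F = 0 := Iff.rfl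

/-- The algebra `A = R / Ann F`. -/
abbrev quotAlg (F : MvPolynomial (Fin 2) K) : Type _ := MvPolynomial (Fin 2) K ⧸ annF F

/-- The degree-`u` component `A_u` of `A = R / Ann F`: the classes of forms of degree `u`. -/
def gradedPiece (F : MvPolynomial (Fin 2) K) (u : ℕ) : Submodule K (quotAlg F) :=
  (homogeneousSubmodule (Fin 2) K u).map (Ideal.Quotient.mkₐ K (annF F)).toLinearMap

/-- The Hilbert function `H(A)` of `A = R / Ann F`. -/
def hilbertFn (F : MvPolynomial (Fin 2) K) (u : ℕ) : ℕ := Module.finrank K (gradedPiece F u)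

/-- The sequence `T(d,k) = (1, 2, …, d - 1, d, …, d, d - 1, …, 2, 1, 0, 0, …)` in which the value
`d` occurs `k` times, in degrees `d - 1, …, d + k - 2`; the last nonzero entry is in degree
`2d + k - 3` (for `d, k ≥ 1`; the subtraction is truncated, which gives the zeros beyond). -/
def ciSeq (d k u : ℕ) : ℕ := min (u + 1) (min d (2 * d + k - 2 - u))

/-- The action by differentiation on `F` descends to `A = R / Ann F`: the class of `f` is sent to
`f ∘ F`. -/
def quotAct (F : MvPolynomial (Fin 2) K) : quotAlg F →ₗ[K] MvPolynomial (Fin 2) K :=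
  ((annF F).restrictScalars K).liftQ (diffAct.flip F) (fun _ hf => hf) ∘ₗ
    (Submodule.Quotient.restrictScalarsEquiv K (annF F)).symm.toLinearMap

theorem quotAct_mk (F f : MvPolynomial (Fin 2) K) :
    quotAct F (Ideal.Quotient.mk (annF F) f) = diffAct f F := rfl

/-- The Hessian matrix `[α_u α_v ∘ F]` of order `i` of `F` with respect to a basis `α` of `A_i`. -/
def hessMatrix (F : MvPolynomial (Fin 2) K) (i : ℕ) {ι : Type*}
    (α : Module.Basis ι K (gradedPiece F i)) : Matrix ι ι (MvPolynomial (Fin 2) K) :=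
  Matrix.of fun u v => quotAct F ((α u : quotAlg F) * (α v : quotAlg F))

/-- The Hessian determinant `h^i(F)`, computed in a basis `α` of `A_i`, evaluated at the point
`p_ℓ = (a, b)` that corresponds to `ℓ = a x + b y`. -/
def hessAt (F : MvPolynomial (Fin 2) K) (i : ℕ) {ι : Type*} [Fintype ι] [DecidableEq ι]
    (α : Module.Basis ι K (gradedPiece F i)) (a b : K) : K :=
  eval ![a, b] (hessMatrix F i α).det

/-- The linear form `ℓ = a x + b y` of `R`. -/
def linForm (a b : K) : MvPolynomial (Fin 2) K := C a * X 0 + C b * X 1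

/-- Multiplication by the class of `ℓ` on `A = R / Ann F`. -/
def multBy (F ℓ : MvPolynomial (Fin 2) K) : Module.End K (quotAlg F) :=
  LinearMap.mulLeft K (Ideal.Quotient.mk (annF F) ℓ)

/-- `P = (p_1 ≥ p_2 ≥ ⋯ ≥ p_s)`, with positive parts, is the Jordan type of the nilpotent
endomorphism `φ` of `V`: there is a basis of `V` made of strings
`v_r, φ v_r, …, φ ^ (p_r - 1) v_r` with `φ ^ p_r v_r = 0`, one for each part `p_r`
(the Jordan blocks of `φ`). -/
def IsJordanType {V : Type*} [AddCommGroup V] [Module K V] (φ : Module.End K V)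
    (P : List ℕ) : Prop :=
  P.Pairwise (· ≥ ·) ∧ (∀ p ∈ P, 0 < p) ∧
    ∃ b : Module.Basis (Σ r : Fin P.length, Fin (P.get r)) K V,
      ∀ (r : Fin P.length) (m : Fin (P.get r)),
        φ (b ⟨r, m⟩) = if h : (m : ℕ) + 1 < P.get r then b ⟨r, ⟨(m : ℕ) + 1, h⟩⟩ else 0

end CIJordan

end

noncomputable section

namespace CIJordan

open MvPolynomial

variable {K : Type*} [Field K]

/-! Complete ℓ to a basis ℓ, t of the linear forms, and consider the cells (u, m), row u and column
m, with ℓ^m t^u ∉ ℓ^(m+1) A (`IsStandard`). They form a Young diagram that can be read in two ways.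
By columns: column m has as many cells as the rank drops from ℓ^m to ℓ^(m+1), which is the number of
Jordan blocks larger than m; so row u has length p_(u+1) (`lt_getD_iff_isStandard`). By diagonals:
dim ℓ^m A_u counts the cells of rows 0, …, u on the diagonal m + u (`finrank_map_gradedPiece`); for
m = 0, the diagonal lengths are T.

The Hessian at (a, b) is, up to a factorial, the Gram determinant of (x, y) ↦ ℓ^(j-2i) x y ∘ F on
A_i. Since forms pair perfectly in characteristic zero, it is nonzero iff ℓ^(j-2i) is injective on
A_i, that is, iff rows 0, …, i all meet the diagonal j - i (`hessAt_ne_zero_iff_isStandard`).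

The rest is combinatorics. Diagonal v meets rows 0, …, i in at most min(i+1, v+1, j+1-v) cells;
these bounds add up to (i+1)(j+1-i), and all are attained iff the one for v = j - i is
(`forall_lt_iff_sum_eq`). The number of parts is d iff row d is empty (`forall_lt_iff_row_eq_zero`).
Both use that rows from j + 2 - d on are empty: T falls there, while ℓ has at most a one-dimensional
kernel in each degree (`not_isStandard_of_hilbertFn`). -/

/-! ### Binary forms in the coordinates ℓ, t -/

theorem isHomogeneous_linForm (a b : K) : (linForm a b).IsHomogeneous 1 :=
  (isHomogeneous_C_mul_X a 0).add (isHomogeneous_C_mul_X b 1)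

theorem isHomogeneous_linForm_pow (a b : K) (n : ℕ) : (linForm a b ^ n).IsHomogeneous n := by
  simpa using (isHomogeneous_linForm a b).pow n

theorem isHomogeneous_linForm_pow_mul_pow (a b c e : K) (m n : ℕ) :
    (linForm a b ^ m * linForm c e ^ n).IsHomogeneous (m + n) :=
  (isHomogeneous_linForm_pow a b m).mul (isHomogeneous_linForm_pow c e n)

theorem exists_complementary {a b : K} (hab : a ≠ 0 ∨ b ≠ 0) : ∃ c e : K, a * e - b * c = 1 := by
  rcases hab with h | h
  · exact ⟨0, a⁻¹, by simp [h]⟩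
  · exact ⟨-b⁻¹, 0, by simp [h]⟩

/-- A form of degree one is a combination of two independent linear forms. -/
theorem exists_eq_linForm_add {a b c e : K} (h : a * e - b * c = 1) {f : MvPolynomial (Fin 2) K}
    (hf : f.IsHomogeneous 1) : ∃ p q : K, f = C p * linForm a b + C q * linForm c e := by
  have hf' : f ∈ homogeneousSubmodule (Fin 2) K 1 := hf
  have hC : (C a * C e - C b * C c : MvPolynomial (Fin 2) K) = 1 := by
    rw [← C_mul, ← C_mul, ← C_sub, h, C_1]
  rw [homogeneousSubmodule_one_eq_span_X] at hf'
  clear hf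
  induction hf' using Submodule.span_induction with
  | mem x hx =>
    obtain ⟨i, rfl⟩ := hx
    fin_cases i
    · refine ⟨e, -b, ?_⟩
      simp only [linForm, C_neg, Fin.zero_eta]
      linear_combination (-X 0) * hC
    · refine ⟨-c, a, ?_⟩
      simp only [linForm, C_neg, Fin.mk_one]
      linear_combination (-X 1) * hC
  | zero => exact ⟨0, 0, by simp⟩
  | add x y _ _ hx hy =>
    obtain ⟨p, q, rfl⟩ := hx
    obtain ⟨p', q', rfl⟩ := hy
    exact ⟨p + p', q + q', by simp only [C_add]; ring⟩
  | smul r x _ hx =>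
    obtain ⟨p, q, rfl⟩ := hx
    exact ⟨r * p, r * q, by simp only [C_mul, smul_eq_C_mul]; ring⟩

/-- Modulo `ℓ`, a form is a multiple of a power of the complementary linear form. -/
theorem exists_eq_linForm_mul_add {a b c e : K} (h : a * e - b * c = 1) (u : ℕ)
    {f : MvPolynomial (Fin 2) K} (hf : f.IsHomogeneous (u + 1)) :
    ∃ g : MvPolynomial (Fin 2) K, g.IsHomogeneous u ∧
      ∃ r : K, f = linForm a b * g + C r * linForm c e ^ (u + 1) := by
  induction u generalizing f with
  | zero =>
    obtain ⟨p, q, rfl⟩ := exists_eq_linForm_add h (by simpa using hf)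
    exact ⟨C p, isHomogeneous_C _ p, q, by ring⟩
  | succ u ih =>
    have hf' : f ∈ homogeneousSubmodule (Fin 2) K (u + 1 + 1) := hf
    rw [← homogeneousSubmodule_one_pow, pow_succ, homogeneousSubmodule_one_pow] at hf'
    clear hf
    induction hf' using Submodule.mul_induction_on' with
    | mem_mul_mem x hx y hy =>
      obtain ⟨g, hg, r, rfl⟩ := ih hx
      obtain ⟨p, q, rfl⟩ := exists_eq_linForm_add h hy
      refine ⟨C p * (linForm a b * g + C r * linForm c e ^ (u + 1)) + C q * (g * linForm c e), ?_,
        r * q, ?_⟩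
      · exact (IsHomogeneous.C_mul hx p).add ((hg.mul (isHomogeneous_linForm c e)).C_mul q)
      · simp only [C_mul]; ring
    | add x _ y _ hx hy =>
      obtain ⟨g, hg, r, rfl⟩ := hx
      obtain ⟨g', hg', r', rfl⟩ := hy
      exact ⟨g + g', hg.add hg', r + r', by simp only [C_add]; ring⟩

theorem isHomogeneous_zero_iff {f : MvPolynomial (Fin 2) K} :
    f.IsHomogeneous 0 ↔ ∃ r : K, f = C r := by
  constructor
  · intro h
    exact ⟨coeff 0 f, totalDegree_eq_zero_iff_eq_C.mp ((Nat.le_zero.mp h.totalDegree_le))⟩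
  · rintro ⟨r, rfl⟩
    exact isHomogeneous_C _ r

attribute [local instance] MvPolynomial.gradedAlgebra in
theorem homogeneousComponent_mul_of_isHomogeneous {σ : Type*} {p : ℕ} {f : MvPolynomial σ K}
    (hf : f.IsHomogeneous p) (g : MvPolynomial σ K) (n : ℕ) :
    homogeneousComponent n (f * g) =
      if p ≤ n then f * homogeneousComponent (n - p) g else 0 := by
  simpa only [← decomposition.decompose'_apply, DirectSum.Decomposition.decompose'_eq] using
    DirectSum.coe_decompose_mul_of_left_mem (homogeneousSubmodule σ K) (b := g) n hf

/-! ### The differentiation action on forms -/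

theorem partialD_pow_isHomogeneous (i : Fin 2) (m : ℕ) {n : ℕ} {G : MvPolynomial (Fin 2) K}
    (hG : G.IsHomogeneous n) :
    ((partialD K i ^ m) G).IsHomogeneous (n - m) ∧ (n < m → (partialD K i ^ m) G = 0) := by
  induction m with
  | zero => exact ⟨by simpa using hG, by simp⟩
  | succ m ih =>
    rw [pow_succ', Module.End.mul_apply]
    refine ⟨by simpa [partialD, Nat.sub_sub] using ih.1.pderiv (i := i), fun h => ?_⟩
    rcases Nat.lt_or_ge n m with h' | h'
    · rw [ih.2 h', map_zero]
    · have h0 : n - m = 0 := by omega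
      obtain ⟨r, hr⟩ := isHomogeneous_zero_iff.mp (h0 ▸ ih.1)
      rw [hr]
      simp [partialD]

theorem diffAct_isHomogeneous {n j : ℕ} {f G : MvPolynomial (Fin 2) K} (hf : f.IsHomogeneous n)
    (hG : G.IsHomogeneous j) :
    (diffAct f G).IsHomogeneous (j - n) ∧ (j < n → diffAct f G = 0) := by
  have key : ∀ m ∈ f.support, (diffAct (monomial m (coeff m f)) G).IsHomogeneous (j - n) ∧
      (j < n → diffAct (monomial m (coeff m f)) G = 0) := by
    intro m hm
    have hn : m 0 + m 1 = n := by
      have := hf.degree_eq_sum_deg_support hm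
      rw [this, ← Finsupp.degree_apply, Finsupp.degree_eq_sum, Fin.sum_univ_two]
    rw [diffAct_monomial, LinearMap.smul_apply, Module.End.mul_apply, smul_eq_C_mul]
    have h1 := partialD_pow_isHomogeneous 1 (m 1) hG
    have h0 := partialD_pow_isHomogeneous 0 (m 0) h1.1
    refine ⟨(by simpa [← hn, Nat.sub_sub, add_comm] using h0.1 : IsHomogeneous _ _).C_mul _,
      fun h => ?_⟩
    rcases Nat.lt_or_ge j (m 1) with h' | h'
    · rw [h1.2 h']; simp
    · rw [h0.2 (by omega), mul_zero]
  have hsum : diffAct f G = ∑ m ∈ f.support, diffAct (monomial m (coeff m f)) G := by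
    conv_lhs => rw [f.as_sum]
    rw [map_sum, LinearMap.sum_apply]
  rw [hsum]
  exact ⟨IsHomogeneous.sum _ _ _ fun m hm => (key m hm).1,
    fun h => Finset.sum_eq_zero fun m hm => (key m hm).2 h⟩

theorem diffAct_C (r : K) (G : MvPolynomial (Fin 2) K) : diffAct (C r) G = r • G := by
  rw [C_apply, diffAct_monomial]; simp

theorem diffAct_X (i : Fin 2) (G : MvPolynomial (Fin 2) K) : diffAct (X i) G = pderiv i G := by
  rw [X, diffAct_monomial]
  fin_cases i <;> simp [partialD]

theorem diffAct_linForm (a b : K) (G : MvPolynomial (Fin 2) K) :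
    diffAct (linForm a b) G = a • pderiv 0 G + b • pderiv 1 G := by
  simp only [linForm, map_add, diffAct_mul, LinearMap.add_apply, Module.End.mul_apply, diffAct_C,
    diffAct_X]

/-- The value of a form at `(a, b)` is, up to a factorial, obtained by applying a power of
`a ∂/∂X + b ∂/∂Y`. -/
theorem diffAct_linForm_pow (a b : K) {n : ℕ} {G : MvPolynomial (Fin 2) K}
    (hG : G.IsHomogeneous n) :
    diffAct (linForm a b ^ n) G = C (n.factorial * eval ![a, b] G) := by
  induction n generalizing G with
  | zero =>
    obtain ⟨r, rfl⟩ := isHomogeneous_zero_iff.mp hG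
    rw [pow_zero, ← C_1, diffAct_C]; simp
  | succ n ih =>
    have h1 : (diffAct (linForm a b) G).IsHomogeneous n := by
      simpa using (diffAct_isHomogeneous (isHomogeneous_linForm a b) hG).1
    rw [pow_succ, diffAct_mul, Module.End.mul_apply, ih h1, diffAct_linForm, Nat.factorial_succ]
    have euler := congrArg (eval ![a, b]) hG.sum_X_mul_pderiv
    simp only [Fin.sum_univ_two, map_add, map_mul, eval_X, map_nsmul] at euler
    simp only [Matrix.cons_val_zero, Matrix.cons_val_one, nsmul_eq_mul] at euler
    rw [eval_add, smul_eval, smul_eval, euler]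
    congr 1
    push_cast
    ring

/-- Nondegeneracy of the pairing between forms of equal degree: by induction all partial derivatives
vanish, and Euler's formula recovers G because n + 1 is invertible. -/
theorem eq_zero_of_diffAct_eq_zero [CharZero K] {n : ℕ} {G : MvPolynomial (Fin 2) K}
    (hG : G.IsHomogeneous n)
    (h : ∀ f : MvPolynomial (Fin 2) K, f.IsHomogeneous n → diffAct f G = 0) : G = 0 := by
  induction n generalizing G with
  | zero =>
    have := h 1 (isHomogeneous_one _ _)
    rwa [← C_1, diffAct_C, one_smul] at this
  | succ n ih =>
    have hp : ∀ i, pderiv i G = 0 := fun i => by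
      refine ih (by simpa using hG.pderiv (i := i)) fun f hf => ?_
      have := h (f * X i) (hf.mul (isHomogeneous_X _ i))
      rwa [diffAct_mul, Module.End.mul_apply, diffAct_X] at this
    have euler := hG.sum_X_mul_pderiv
    simp only [hp, mul_zero, Finset.sum_const_zero] at euler
    exact (smul_eq_zero.mp euler.symm).resolve_left n.succ_ne_zero

/-- Modulo ℓ every form of degree n is a scalar times t^n, so once ℓ kills G only t^n remains to be
tested. -/
theorem eq_zero_of_diffAct_linForm_eq_zero [CharZero K] {a b c e : K} (h : a * e - b * c = 1)
    {n : ℕ} {G : MvPolynomial (Fin 2) K} (hG : G.IsHomogeneous n)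
    (h1 : diffAct (linForm a b) G = 0) (h2 : diffAct (linForm c e ^ n) G = 0) : G = 0 := by
  refine eq_zero_of_diffAct_eq_zero hG fun f hf => ?_
  cases n with
  | zero =>
    obtain ⟨r, rfl⟩ := isHomogeneous_zero_iff.mp hf
    rw [pow_zero, ← C_1, diffAct_C, one_smul] at h2
    rw [h2, map_zero]
  | succ n =>
    obtain ⟨g, -, r, rfl⟩ := exists_eq_linForm_mul_add h n hf
    rw [mul_comm (linForm a b) g, map_add, diffAct_mul, diffAct_mul, LinearMap.add_apply,
      Module.End.mul_apply, Module.End.mul_apply, h1, h2, map_zero, map_zero, add_zero]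

/-- The annihilator of a form is a homogeneous ideal. -/
theorem homogeneousComponent_mem_annF {j : ℕ} {F : MvPolynomial (Fin 2) K}
    (hF : F.IsHomogeneous j) {f : MvPolynomial (Fin 2) K} (hf : f ∈ annF F) (n : ℕ) :
    homogeneousComponent n f ∈ annF F := by
  rw [mem_annF] at hf ⊢
  have hn := diffAct_isHomogeneous (homogeneousComponent_isHomogeneous n f) hF
  rcases Nat.lt_or_ge j n with h | h
  · exact hn.2 h
  have key : homogeneousComponent (j - n) (diffAct f F) = diffAct (homogeneousComponent n f) F := by
    conv_lhs => rw [← sum_homogeneousComponent f]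
    rw [map_sum, LinearMap.sum_apply, map_sum, Finset.sum_eq_single n]
    · exact homogeneousComponent_eq_self hn.1
    · intro i _ hi
      have hi' := diffAct_isHomogeneous (homogeneousComponent_isHomogeneous i f) hF
      rcases Nat.lt_or_ge j i with h' | h'
      · rw [hi'.2 h', map_zero]
      · rw [homogeneousComponent_of_mem hi'.1, if_neg (by omega)]
    · intro hn'
      rw [homogeneousComponent_eq_zero n f (by simpa using hn')]
      simp
  rw [← key, hf, map_zero]

/-- A bounded down-closed set of naturals is an initial segment, so its cardinality determines it.
This turns equal column lengths into equal diagrams. -/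
theorem lt_card_filter_range_iff {p : ℕ → Prop} [DecidablePred p] (hp : ∀ u v, u ≤ v → p v → p u)
    {N : ℕ} (hN : ∀ u, p u → u < N) (u : ℕ) :
    u < ((Finset.range N).filter p).card ↔ p u := by
  constructor
  · intro h
    by_contra hu
    have : (Finset.range N).filter p ⊆ Finset.range u := fun v hv => by
      rw [Finset.mem_filter] at hv
      rw [Finset.mem_range]
      by_contra hv'
      exact hu (hp u v (not_lt.mp hv') hv.2)
    have := Finset.card_le_card this
    rw [Finset.card_range] at this
    omega
  · intro h
    have : Finset.range (u + 1) ⊆ (Finset.range N).filter p := fun v hv => by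
      rw [Finset.mem_range] at hv
      have hv' := hp v u (by omega) h
      exact Finset.mem_filter.mpr ⟨Finset.mem_range.mpr (hN v hv'), hv'⟩
    have := Finset.card_le_card this
    rw [Finset.card_range] at this
    omega

/-! ### Jordan blocks and ranks of powers -/

section JordanType

variable {V : Type*} [AddCommGroup V] [Module K V] {φ : Module.End K V} {P : List ℕ}

theorem IsJordanType.finite (h : IsJordanType φ P) : Module.Finite K V := by
  obtain ⟨-, -, b, -⟩ := h
  exact Module.Finite.of_basis b

theorem IsJordanType.getD_antitone (h : IsJordanType φ P) {u v : ℕ} (huv : u ≤ v) :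
    P.getD v 0 ≤ P.getD u 0 := by
  rcases lt_or_ge v P.length with hv | hv
  · rw [List.getD_eq_getElem _ _ hv, List.getD_eq_getElem _ _ (huv.trans_lt hv)]
    rcases huv.eq_or_lt with rfl | huv
    · exact le_rfl
    · exact List.pairwise_iff_getElem.mp h.1 u v _ hv huv
  · rw [List.getD_eq_default _ _ hv]
    exact Nat.zero_le _

theorem IsJordanType.getD_pos_iff (h : IsJordanType φ P) {u : ℕ} :
    0 < P.getD u 0 ↔ u < P.length := by
  rcases lt_or_ge u P.length with hu | hu
  · rw [List.getD_eq_getElem _ _ hu]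
    exact ⟨fun _ => hu, fun _ => h.2.1 _ (List.getElem_mem hu)⟩
  · rw [List.getD_eq_default _ _ hu]
    omega

/-- The number of Jordan blocks of size larger than `m` is the drop of rank from `φ ^ m` to
`φ ^ (m + 1)`. -/
theorem IsJordanType.finrank_range_pow (h : IsJordanType φ P) (m : ℕ) :
    Module.finrank K (LinearMap.range (φ ^ m)) =
      Module.finrank K (LinearMap.range (φ ^ (m + 1))) +
        ((Finset.range P.length).filter fun u => m < P.getD u 0).card := by
  classical
  obtain ⟨-, -, b, hb⟩ := h
  have hpow : ∀ (n : ℕ) (r : Fin P.length) (s : Fin (P.get r)), (φ ^ n) (b ⟨r, s⟩) =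
      if h : (s : ℕ) + n < P.get r then b ⟨r, ⟨(s : ℕ) + n, h⟩⟩ else 0 := by
    intro n r s
    induction n with
    | zero => simp
    | succ n ih =>
      rw [pow_succ', Module.End.mul_apply, ih]
      split_ifs with h1 h2 h2
      · rw [hb, dif_pos (by simpa [add_assoc] using h2)]
        simp [add_assoc]
      · rw [hb, dif_neg (by simpa [add_assoc] using h2)]
      · omega
      · exact map_zero _
  have hrank : ∀ n : ℕ, Module.finrank K (LinearMap.range (φ ^ n)) =
      (Finset.univ.filter fun x : Σ r : Fin P.length, Fin (P.get r) => n ≤ (x.2 : ℕ)).card := by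
    intro n
    have hspan : LinearMap.range (φ ^ n) = Submodule.span K (Set.range
        (b ∘ (Subtype.val : {x : Σ r : Fin P.length, Fin (P.get r) // n ≤ (x.2 : ℕ)} → _))) := by
      rw [LinearMap.range_eq_map, ← b.span_eq, Submodule.map_span]
      apply le_antisymm
      · rw [Submodule.span_le]
        rintro _ ⟨_, ⟨⟨r, s⟩, rfl⟩, rfl⟩
        rw [hpow]
        split_ifs with h1
        · exact Submodule.subset_span ⟨⟨⟨r, ⟨s + n, h1⟩⟩, Nat.le_add_left _ _⟩, rfl⟩
        · exact Submodule.zero_mem _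
      · rw [Submodule.span_le]
        rintro _ ⟨⟨⟨r, s⟩, hs⟩, rfl⟩
        have hs' : n ≤ (s : ℕ) := hs
        have hsn : (s : ℕ) - n + n = s := Nat.sub_add_cancel hs'
        refine Submodule.subset_span ⟨b ⟨r, ⟨s - n, by omega⟩⟩, ⟨_, rfl⟩, ?_⟩
        rw [hpow, dif_pos (show (s : ℕ) - n + n < P.get r from hsn.symm ▸ s.2)]
        exact congrArg (fun s => b ⟨r, s⟩) (Fin.ext hsn)
    rw [hspan, finrank_span_eq_card (b.linearIndependent.comp _ Subtype.val_injective),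
      Fintype.card_subtype]
  rw [hrank, hrank]
  have hsplit : (Finset.univ.filter fun x : Σ r : Fin P.length, Fin (P.get r) => m ≤ (x.2 : ℕ)) =
      (Finset.univ.filter fun x : Σ r : Fin P.length, Fin (P.get r) => m + 1 ≤ (x.2 : ℕ)) ∪
      (Finset.univ.filter fun x : Σ r : Fin P.length, Fin (P.get r) => (x.2 : ℕ) = m) := by
    ext x
    simp only [Finset.mem_filter, Finset.mem_univ, true_and, Finset.mem_union]
    omega
  rw [hsplit, Finset.card_union_of_disjoint]
  · congr 1
    refine Finset.card_bij (fun x _ => (x.1 : ℕ)) ?_ ?_ ?_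
    · rintro ⟨r, s⟩ hx
      have hx' : (s : ℕ) = m := (Finset.mem_filter.mp hx).2
      refine Finset.mem_filter.mpr ⟨Finset.mem_range.mpr r.2, ?_⟩
      rw [List.getD_eq_getElem _ _ r.2, ← hx']
      exact s.2
    · rintro ⟨r, s⟩ hx ⟨r', s'⟩ hx' hr
      obtain rfl : r = r' := Fin.ext hr
      have h1 : (s : ℕ) = m := (Finset.mem_filter.mp hx).2
      have h2 : (s' : ℕ) = m := (Finset.mem_filter.mp hx').2
      obtain rfl : s = s' := Fin.ext (h1.trans h2.symm)
      rfl
    · intro u hu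
      obtain ⟨hu, hm⟩ := Finset.mem_filter.mp hu
      rw [Finset.mem_range] at hu
      rw [List.getD_eq_getElem _ _ hu] at hm
      exact ⟨⟨⟨u, hu⟩, ⟨m, hm⟩⟩, by simp, rfl⟩
  · rw [Finset.disjoint_left]
    intro x hx hx'
    rw [Finset.mem_filter] at hx hx'
    omega

end JordanType

/-! ### Combinatorics of the diagram: rows against diagonals -/

theorem sum_take_eq_sum_getD (P : List ℕ) (n : ℕ) :
    (P.take n).sum = ∑ u ∈ Finset.range n, P.getD u 0 := by
  induction P generalizing n with
  | nil => simp
  | cons p P ih =>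
    cases n with
    | zero => simp
    | succ n => simp [Finset.sum_range_succ', ih, add_comm]

theorem sum_range_sub_two_mul {i j : ℕ} (hij : 2 * i ≤ j) :
    ∑ u ∈ Finset.range (i + 1), (j + 1 - 2 * u) = (i + 1) * (j + 1 - i) := by
  induction i with
  | zero => simp
  | succ i ih =>
    rw [Finset.sum_range_succ, ih (by omega)]
    obtain ⟨r, rfl⟩ := Nat.exists_eq_add_of_le hij
    have h1 : 2 * (i + 1) + r + 1 - i = i + 3 + r := by omega
    have h2 : 2 * (i + 1) + r + 1 - 2 * (i + 1) = r + 1 := by omega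
    have h3 : 2 * (i + 1) + r + 1 - (i + 1) = i + 2 + r := by omega
    rw [h1, h2, h3]
    ring

/-- Counting the cells of the first `i + 1` rows of a diagram by diagonals. -/
theorem sum_eq_sum_card_diagonal {q : ℕ → ℕ} {i N : ℕ}
    (h : ∀ u ≤ i, u + q u ≤ N) :
    ∑ u ∈ Finset.range (i + 1), q u = ∑ v ∈ Finset.range N,
      ((Finset.range (i + 1)).filter fun u => u ≤ v ∧ v < u + q u).card := by
  simp_rw [Finset.card_filter]
  rw [Finset.sum_comm]
  refine Finset.sum_congr rfl fun u hu => ?_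
  have hu' := h u (Nat.lt_succ_iff.mp (Finset.mem_range.mp hu))
  rw [← Finset.card_filter]
  have : (Finset.range N).filter (fun v => u ≤ v ∧ v < u + q u) =
      Finset.Ico (u) (u + q u) := by
    ext v
    simp only [Finset.mem_filter, Finset.mem_range, Finset.mem_Ico]
    omega
  rw [this, Nat.card_Ico]
  omega

section Diagram

variable {d k j : ℕ} {q : ℕ → ℕ}

theorem card_le_ciSeq (hT : ∀ v, ((Finset.range (v + 1)).filter fun u => v - u < q u).card =
    ciSeq d k v) (i v : ℕ) :
    ((Finset.range (i + 1)).filter fun u => u ≤ v ∧ v < u + q u).card ≤ ciSeq d k v := by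
  rw [← hT]
  refine Finset.card_le_card fun u hu => ?_
  simp only [Finset.mem_filter, Finset.mem_range] at hu ⊢
  omega

/-- The last cell of row u lies on the diagonal u + q u - 1, and T vanishes beyond degree j. -/
theorem add_le_of_ciSeq (hd : 1 ≤ d) (hk : 1 ≤ k) (hj : j + 3 = 2 * d + k)
    (hT : ∀ v, ((Finset.range (v + 1)).filter fun u => v - u < q u).card = ciSeq d k v)
    {u : ℕ} (hu : 0 < q u) : u + q u ≤ j + 1 := by
  by_contra hlt
  have h := hT (u + q u - 1)
  have h0 : ciSeq d k (u + q u - 1) = 0 := by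
    unfold ciSeq
    omega
  rw [h0, Finset.card_eq_zero, Finset.filter_eq_empty_iff] at h
  exact h (x := u) (Finset.mem_range.mpr (by omega)) (by omega)

theorem forall_lt_iff_sum_eq (hd : 1 ≤ d) (hk : 1 ≤ k) (hj : j + 3 = 2 * d + k)
    (hT : ∀ v, ((Finset.range (v + 1)).filter fun u => v - u < q u).card = ciSeq d k v)
    (h0 : ∀ v, j + 2 ≤ v + d → q v = 0) {i : ℕ} (hi : i ≤ d - 1) :
    (∀ u ≤ i, j - i - u < q u) ↔ ∑ u ∈ Finset.range (i + 1), q u = (i + 1) * (j + 1 - i) := by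
  have hij : 2 * i ≤ j := by omega
  -- Compare with the diagram whose rows have length j + 1 - 2u: it attains the maximal count on
  -- every diagonal.
  rw [← sum_range_sub_two_mul hij, sum_eq_sum_card_diagonal (N := j + 1) (q := q),
    sum_eq_sum_card_diagonal (N := j + 1) (q := fun u => j + 1 - 2 * u)]
  rotate_left
  · intro u hu
    omega
  · intro u hu
    rcases Nat.eq_zero_or_pos (q u) with h | h
    · omega
    · exact add_le_of_ciSeq hd hk hj hT h
  have hM : ∀ v ≤ j, ((Finset.range (i + 1)).filter
      fun u => u ≤ v ∧ v < u + (j + 1 - 2 * u)).card = min (i + 1) (min (v + 1) (j + 1 - v)) := by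
    intro v hv
    rw [← Finset.card_range (min (i + 1) (min (v + 1) (j + 1 - v)))]
    congr 1
    ext u
    simp only [Finset.mem_filter, Finset.mem_range]
    omega
  have hN : ∀ v ≤ j, ((Finset.range (i + 1)).filter fun u => u ≤ v ∧ v < u + q u).card ≤
      min (i + 1) (min (v + 1) (j + 1 - v)) := by
    intro v hv
    have h1 := card_le_ciSeq hT i v
    have h2 := Finset.card_filter_le (Finset.range (i + 1)) (fun u => u ≤ v ∧ v < u + q u)
    rw [Finset.card_range] at h2
    unfold ciSeq at h1
    omega
  constructor
  · intro h
    refine Finset.sum_congr rfl fun v hv => ?_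
    have hv' : v ≤ j := Nat.lt_succ_iff.mp (Finset.mem_range.mp hv)
    rw [hM v hv']
    refine le_antisymm (hN v hv') ?_
    -- Up to the diagonal j - i the rows are long enough by hypothesis; past it, all the cells that
    -- T prescribes must lie in rows 0, …, i.
    rcases le_total v (j - i) with hvi | hvi
    · rw [← Finset.card_range (min (i + 1) (min (v + 1) (j + 1 - v)))]
      refine Finset.card_le_card fun u hu => ?_
      simp only [Finset.mem_filter, Finset.mem_range] at hu ⊢
      have := h u (by omega)
      omega
    · -- no row below row `i` meets a diagonal `v ≥ j - i`
      have hempty : ∀ u, i < u → u ≤ v → ¬ v - u < q u := by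
        intro u hiu huv hlt
        rcases Nat.lt_or_ge (j - i) u with hu | hu
        · have := h0 u (by omega)
          omega
        · have hsub : insert u (Finset.range (i + 1)) ⊆
              (Finset.range (j - i + 1)).filter fun w => j - i - w < q w := by
            intro w hw
            simp only [Finset.mem_insert, Finset.mem_filter, Finset.mem_range] at hw ⊢
            rcases hw with rfl | hw
            · omega
            · exact ⟨by omega, h w (by omega)⟩
          have hcard := Finset.card_le_card hsub
          rw [hT, Finset.card_insert_of_notMem (by simp; omega), Finset.card_range] at hcard
          unfold ciSeq at hcard
          omega
      have hle : ciSeq d k v ≤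
          ((Finset.range (i + 1)).filter fun u => u ≤ v ∧ v < u + q u).card := by
        rw [← hT]
        refine Finset.card_le_card fun u hu => ?_
        simp only [Finset.mem_filter, Finset.mem_range] at hu ⊢
        have := hempty u
        omega
      refine le_trans ?_ hle
      unfold ciSeq
      omega
  · intro h u hu
    -- Equal sums of termwise bounded counts agree term by term; at v = j - i the bound is i + 1, so
    -- every row is met.
    have heq := (Finset.sum_eq_sum_iff_of_le fun v hv => by
      have hv' : v ≤ j := Nat.lt_succ_iff.mp (Finset.mem_range.mp hv)
      rw [hM v hv']
      exact hN v hv').mp h (j - i) (Finset.mem_range.mpr (by omega))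
    rw [hM _ (Nat.sub_le _ _)] at heq
    have hfull := (Finset.card_filter_eq_iff (s := Finset.range (i + 1))).mp
      (heq.trans (by rw [Finset.card_range]; omega)) u (Finset.mem_range.mpr (by omega))
    omega

/-- The diagonal j - (d - 1) = d + k - 2 has exactly d cells, so rows 0, …, d - 1 fill it as soon as
the rows from d on are empty. Conversely, for k = 1 row d is empty anyway, and for k ≥ 2 a cell in
row d would overfill the diagonal d. -/
theorem forall_lt_iff_row_eq_zero (hd : 1 ≤ d) (hk : 1 ≤ k) (hj : j + 3 = 2 * d + k)
    (hT : ∀ v, ((Finset.range (v + 1)).filter fun u => v - u < q u).card = ciSeq d k v)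
    (hq : ∀ u v, u ≤ v → q v ≤ q u)
    (h0 : ∀ v, j + 2 ≤ v + d → q v = 0) :
    (∀ u ≤ d - 1, j - (d - 1) - u < q u) ↔ q d = 0 := by
  constructor
  · intro h
    rcases hk.eq_or_lt with rfl | hk'
    · exact h0 d (by omega)
    · by_contra hpos
      -- As k ≥ 2, d + k - 2 ≥ d, so rows 0, …, d - 1 also meet the diagonal d; with the cell (d, 0)
      -- this makes d + 1 > T(d) cells.
      have hsub : Finset.range (d + 1) ⊆ (Finset.range (d + 1)).filter fun w => d - w < q w := by
        intro w hw
        simp only [Finset.mem_filter, Finset.mem_range] at hw ⊢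
        refine ⟨hw, ?_⟩
        rcases Nat.lt_succ_iff_lt_or_eq.mp hw with hw' | hw'
        · have := h w (by omega)
          have := hq w d (by omega)
          omega
        · obtain rfl : w = d := by omega
          omega
      have hcard := Finset.card_le_card hsub
      rw [hT, Finset.card_range] at hcard
      unfold ciSeq at hcard
      omega
  · intro h u hu
    have hsub : ((Finset.range (j - (d - 1) + 1)).filter fun w => j - (d - 1) - w < q w) ⊆
        Finset.range d := by
      intro w hw
      simp only [Finset.mem_filter, Finset.mem_range] at hw ⊢
      by_contra hdw
      have := hq d w (by omega)
      omega
    have heq := Finset.eq_of_subset_of_card_le hsub (by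
      rw [hT, Finset.card_range]
      unfold ciSeq
      omega)
    have hu' : u ∈ Finset.range d := Finset.mem_range.mpr (by omega)
    rw [← heq] at hu'
    exact (Finset.mem_filter.mp hu').2

end Diagram

/-! ### The graded algebra A and the diagram of ℓ -/

section Quotient

variable {j : ℕ} {F : MvPolynomial (Fin 2) K}

theorem mk_eq_zero_iff {f : MvPolynomial (Fin 2) K} :
    Ideal.Quotient.mk (annF F) f = 0 ↔ diffAct f F = 0 := by
  rw [Ideal.Quotient.eq_zero_iff_mem, mem_annF]

theorem mem_gradedPiece {u : ℕ} {x : quotAlg F} :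
    x ∈ gradedPiece F u ↔
      ∃ f : MvPolynomial (Fin 2) K, f.IsHomogeneous u ∧ Ideal.Quotient.mk (annF F) f = x :=
  Iff.rfl

theorem mk_mem_gradedPiece {u : ℕ} {f : MvPolynomial (Fin 2) K} (hf : f.IsHomogeneous u) :
    Ideal.Quotient.mk (annF F) f ∈ gradedPiece F u :=
  mem_gradedPiece.mpr ⟨f, hf, rfl⟩

theorem mk_C_mul (r : K) (f : MvPolynomial (Fin 2) K) :
    Ideal.Quotient.mk (annF F) (C r * f) = r • Ideal.Quotient.mk (annF F) f := by
  rw [← smul_eq_C_mul]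
  exact map_smul (Ideal.Quotient.mkₐ K (annF F)) r f

/-- The projection of `A = R / Ann F` onto its component of degree `n`, for a form `F`. -/
def gradedProj (hF : F.IsHomogeneous j) (n : ℕ) : quotAlg F →ₗ[K] quotAlg F :=
  ((annF F).restrictScalars K).liftQ
      ((Ideal.Quotient.mkₐ K (annF F)).toLinearMap ∘ₗ homogeneousComponent n)
      (fun _ hf => Ideal.Quotient.eq_zero_iff_mem.mpr (homogeneousComponent_mem_annF hF hf n)) ∘ₗ
    (Submodule.Quotient.restrictScalarsEquiv K (annF F)).symm.toLinearMap

theorem gradedProj_mk (hF : F.IsHomogeneous j) (n : ℕ) (f : MvPolynomial (Fin 2) K) :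
    gradedProj hF n (Ideal.Quotient.mk (annF F) f) =
      Ideal.Quotient.mk (annF F) (homogeneousComponent n f) := rfl

theorem gradedProj_of_mem (hF : F.IsHomogeneous j) (n : ℕ) {u : ℕ} {x : quotAlg F}
    (hx : x ∈ gradedPiece F u) : gradedProj hF n x = if u = n then x else 0 := by
  obtain ⟨f, hf, rfl⟩ := mem_gradedPiece.mp hx
  rw [gradedProj_mk, homogeneousComponent_of_mem hf]
  rcases eq_or_ne n u with rfl | h
  · rw [if_pos rfl, if_pos rfl]
  · rw [if_neg h, if_neg h.symm, map_zero]

theorem gradedProj_mem (hF : F.IsHomogeneous j) (n : ℕ) (x : quotAlg F) :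
    gradedProj hF n x ∈ gradedPiece F n := by
  obtain ⟨f, rfl⟩ := Ideal.Quotient.mk_surjective x
  exact mk_mem_gradedPiece (homogeneousComponent_isHomogeneous n f)

theorem gradedProj_mul (hF : F.IsHomogeneous j) (n : ℕ) {u : ℕ} {x : quotAlg F}
    (hx : x ∈ gradedPiece F u) (y : quotAlg F) :
    gradedProj hF n (x * y) = if u ≤ n then x * gradedProj hF (n - u) y else 0 := by
  obtain ⟨f, hf, rfl⟩ := mem_gradedPiece.mp hx
  obtain ⟨g, rfl⟩ := Ideal.Quotient.mk_surjective y
  rw [← map_mul, gradedProj_mk, homogeneousComponent_mul_of_isHomogeneous hf, gradedProj_mk]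
  split_ifs
  · exact map_mul _ _ _
  · exact map_zero _

/-- The class of the linear form `a x + b y` in `A = R / Ann F`. -/
def linClass (F : MvPolynomial (Fin 2) K) (a b : K) : quotAlg F :=
  Ideal.Quotient.mk (annF F) (linForm a b)

theorem linClass_pow_mul_pow_mem (a b c e : K) (m n : ℕ) :
    linClass F a b ^ m * linClass F c e ^ n ∈ gradedPiece F (m + n) := by
  simpa only [linClass, map_mul, map_pow] using
    mk_mem_gradedPiece (F := F) (isHomogeneous_linForm_pow_mul_pow a b c e m n)

theorem linClass_pow_mem (a b : K) (n : ℕ) : linClass F a b ^ n ∈ gradedPiece F n := by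
  simpa using linClass_pow_mul_pow_mem (F := F) a b 0 0 n 0

theorem linClass_pow_eq_zero (hF : F.IsHomogeneous j) (a b : K) {n : ℕ} (hn : j < n) :
    linClass F a b ^ n = 0 := by
  rw [linClass, ← map_pow, mk_eq_zero_iff]
  exact (diffAct_isHomogeneous (isHomogeneous_linForm_pow a b n) hF).2 hn

theorem gradedPiece_zero : gradedPiece F 0 = Submodule.span K {1} := by
  apply le_antisymm
  · intro x hx
    obtain ⟨f, hf, rfl⟩ := mem_gradedPiece.mp hx
    obtain ⟨r, rfl⟩ := isHomogeneous_zero_iff.mp hf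
    rw [← mul_one (C r), mk_C_mul, map_one]
    exact Submodule.smul_mem _ _ (Submodule.mem_span_singleton_self _)
  · rw [Submodule.span_singleton_le_iff_mem]
    exact mk_mem_gradedPiece (isHomogeneous_one _ _)

theorem gradedPiece_succ {a b c e : K} (h : a * e - b * c = 1) (u : ℕ) :
    gradedPiece F (u + 1) = (gradedPiece F u).map (LinearMap.mulLeft K (linClass F a b)) ⊔
      Submodule.span K {linClass F c e ^ (u + 1)} := by
  apply le_antisymm
  · intro x hx
    obtain ⟨f, hf, rfl⟩ := mem_gradedPiece.mp hx
    obtain ⟨g, hg, r, rfl⟩ := exists_eq_linForm_mul_add h u hf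
    rw [map_add, map_mul, mk_C_mul, map_pow]
    exact Submodule.add_mem_sup ⟨_, mk_mem_gradedPiece hg, rfl⟩
      (Submodule.smul_mem _ _ (Submodule.mem_span_singleton_self _))
  · refine sup_le ?_ ?_
    · rintro _ ⟨x, hx, rfl⟩
      obtain ⟨f, hf, rfl⟩ := mem_gradedPiece.mp hx
      rw [LinearMap.mulLeft_apply, linClass, ← map_mul, mul_comm]
      exact mk_mem_gradedPiece (hf.mul (isHomogeneous_linForm a b))
    · rw [Submodule.span_singleton_le_iff_mem]
      exact linClass_pow_mem c e (u + 1)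

theorem map_gradedPiece_succ {a b c e : K} (h : a * e - b * c = 1) (m u : ℕ) :
    (gradedPiece F (u + 1)).map (LinearMap.mulLeft K (linClass F a b ^ m)) =
      (gradedPiece F u).map (LinearMap.mulLeft K (linClass F a b ^ (m + 1))) ⊔
        Submodule.span K {linClass F a b ^ m * linClass F c e ^ (u + 1)} := by
  rw [gradedPiece_succ h, Submodule.map_sup, Submodule.map_span, Set.image_singleton,
    ← Submodule.map_comp, ← LinearMap.mulLeft_mul, ← pow_succ, LinearMap.mulLeft_apply]

/-- `ℓ ^ m t ^ u` does not lie in `ℓ ^ (m + 1) A`, where `ℓ = a x + b y` and `t = c x + e y`. -/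
def IsStandard (F : MvPolynomial (Fin 2) K) (a b c e : K) (u m : ℕ) : Prop :=
  linClass F a b ^ m * linClass F c e ^ u ∉
    LinearMap.range (LinearMap.mulLeft K (linClass F a b ^ (m + 1)))

/-- A relation ℓ^m t^u ∈ ℓ^(m+1) A persists after multiplication by powers of ℓ and t; hence the
cells form a Young diagram. -/
theorem IsStandard.mono {a b c e : K} {u v m n : ℕ} (huv : u ≤ v) (hmn : m ≤ n)
    (h : IsStandard F a b c e v n) : IsStandard F a b c e u m := by
  rintro ⟨x, hx⟩
  refine h ⟨linClass F c e ^ (v - u) * x, ?_⟩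
  obtain ⟨v, rfl⟩ := Nat.exists_eq_add_of_le huv
  obtain ⟨n, rfl⟩ := Nat.exists_eq_add_of_le hmn
  rw [LinearMap.mulLeft_apply] at hx ⊢
  rw [Nat.add_sub_cancel_left]
  linear_combination linClass F a b ^ n * linClass F c e ^ v * hx

theorem IsStandard.lt (hF : F.IsHomogeneous j) {a b c e : K} {u m : ℕ}
    (h : IsStandard F a b c e u m) : u < j + 1 := by
  by_contra hu
  exact h ⟨0, by rw [linClass_pow_eq_zero hF c e (by omega)]; simp⟩

theorem not_isStandard_zero_iff (hF : F.IsHomogeneous j) {a b c e : K} {m : ℕ} :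
    ¬ IsStandard F a b c e 0 m ↔ linClass F a b ^ m = 0 := by
  rw [IsStandard, not_not, pow_zero, mul_one]
  constructor
  · rintro ⟨x, hx⟩
    rw [LinearMap.mulLeft_apply] at hx
    have h1 := gradedProj_mul hF m (linClass_pow_mem a b (m + 1)) x
    rwa [hx, if_neg (by omega), gradedProj_of_mem hF m (linClass_pow_mem a b m), if_pos rfl] at h1
  · intro h
    exact ⟨0, by simp [h]⟩

/-- Projecting to degree m + u + 1 replaces the cofactor of ℓ^(m+1) by its component of degree u. -/
theorem not_isStandard_succ_iff (hF : F.IsHomogeneous j) {a b c e : K} {u m : ℕ} :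
    ¬ IsStandard F a b c e (u + 1) m ↔ linClass F a b ^ m * linClass F c e ^ (u + 1) ∈
      (gradedPiece F u).map (LinearMap.mulLeft K (linClass F a b ^ (m + 1))) := by
  rw [IsStandard, not_not]
  constructor
  · rintro ⟨x, hx⟩
    rw [LinearMap.mulLeft_apply] at hx
    have h1 := gradedProj_mul hF (m + (u + 1)) (linClass_pow_mem a b (m + 1)) x
    rw [hx, if_pos (by omega),
      gradedProj_of_mem hF _ (linClass_pow_mul_pow_mem a b c e m (u + 1)), if_pos rfl] at h1
    refine ⟨_, gradedProj_mem hF u x, ?_⟩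
    rw [LinearMap.mulLeft_apply, h1]
    congr 3
    omega
  · rintro ⟨x, -, hx⟩
    exact ⟨x, hx⟩

theorem finrank_sup_span_singleton_eq {V : Type*} [AddCommGroup V] [Module K V] [Module.Finite K V]
    {W : Submodule K V} {v : V} {p : Prop} [Decidable p] (hp : ¬ p ↔ v ∈ W) :
    Module.finrank K ↥(W ⊔ Submodule.span K {v}) = Module.finrank K W + if p then 1 else 0 := by
  split_ifs with h
  · exact Submodule.finrank_sup_span_singleton (fun hv => hp.mpr hv h)
  · rw [sup_eq_left.mpr ((Submodule.span_singleton_le_iff_mem _ _).mpr (hp.mp h)), add_zero]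

open Classical in
/-- The dimension of `ℓ ^ m A_u` is the number of cells of the diagram on the diagonal `m + u` that
lie in the rows `0, …, u`. -/
theorem finrank_map_gradedPiece [Module.Finite K (quotAlg F)] (hF : F.IsHomogeneous j)
    {a b c e : K} (h : a * e - b * c = 1) (u m : ℕ) :
    Module.finrank K ((gradedPiece F u).map (LinearMap.mulLeft K (linClass F a b ^ m))) =
      ((Finset.range (u + 1)).filter fun w => IsStandard F a b c e w (m + u - w)).card := by
  induction u generalizing m with
  | zero =>
    rw [gradedPiece_zero, Submodule.map_span, Set.image_singleton, LinearMap.mulLeft_apply, mul_one,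
      ← bot_sup_eq (Submodule.span K _), finrank_sup_span_singleton_eq
        ((not_isStandard_zero_iff hF (c := c) (e := e)).trans (Submodule.mem_bot K).symm),
      finrank_bot, zero_add, zero_add, Finset.range_one, Finset.filter_singleton]
    simp only [add_zero, Nat.sub_zero]
    split_ifs <;> simp
  | succ u ih =>
    rw [map_gradedPiece_succ h, finrank_sup_span_singleton_eq (not_isStandard_succ_iff hF), ih,
      Finset.range_add_one (n := u + 1), Finset.filter_insert]
    have h1 : m + 1 + u = m + (u + 1) := by omega
    rw [h1, Nat.add_sub_cancel]
    split_ifs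
    · rw [Finset.card_insert_of_notMem (by simp)]
    · rfl

theorem exists_mem_range_sup_span (hF : F.IsHomogeneous j) {a b c e : K} (h : a * e - b * c = 1)
    (x : quotAlg F) : x ∈ LinearMap.range (LinearMap.mulLeft K (linClass F a b)) ⊔
      Submodule.span K ((fun u => linClass F c e ^ u) '' Set.Iio (j + 1)) := by
  obtain ⟨f, rfl⟩ := Ideal.Quotient.mk_surjective x
  rw [← sum_homogeneousComponent f, map_sum]
  refine Submodule.sum_mem _ fun u _ => ?_
  have hu := mk_mem_gradedPiece (F := F) (homogeneousComponent_isHomogeneous u f)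
  have hpow : ∀ u, linClass F c e ^ u ∈
      Submodule.span K ((fun u => linClass F c e ^ u) '' Set.Iio (j + 1)) := by
    intro u
    rcases Nat.lt_or_ge u (j + 1) with h | h
    · exact Submodule.subset_span ⟨u, h, rfl⟩
    · rw [linClass_pow_eq_zero hF c e h]
      exact Submodule.zero_mem _
  cases u with
  | zero =>
    rw [gradedPiece_zero] at hu
    refine Submodule.mem_sup_right ?_
    exact (Submodule.span_singleton_le_iff_mem _ _).mpr (by simpa using hpow 0) hu
  | succ u =>
    rw [gradedPiece_succ h] at hu
    exact sup_le_sup LinearMap.map_le_range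
      ((Submodule.span_singleton_le_iff_mem _ _).mpr (hpow (u + 1))) hu

open Classical in
/-- The drop of rank from `ℓ ^ m` to `ℓ ^ (m + 1)` is the length of the `m`-th column of the
diagram. -/
theorem finrank_range_mulLeft_pow [Module.Finite K (quotAlg F)] (hF : F.IsHomogeneous j)
    {a b c e : K} (h : a * e - b * c = 1) (m : ℕ) :
    Module.finrank K (LinearMap.range (LinearMap.mulLeft K (linClass F a b ^ m))) =
      Module.finrank K (LinearMap.range (LinearMap.mulLeft K (linClass F a b ^ (m + 1)))) +
        ((Finset.range (j + 1)).filter fun u => IsStandard F a b c e u m).card := by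
  -- Filter ℓ^m A above ℓ^(m+1) A by adjoining the ℓ^m t^u one at a time; each step adds a dimension
  -- exactly at a cell.
  let W : ℕ → Submodule K (quotAlg F) := fun n =>
    LinearMap.range (LinearMap.mulLeft K (linClass F a b ^ (m + 1))) ⊔
      Submodule.span K ((fun u => linClass F a b ^ m * linClass F c e ^ u) '' Set.Iio n)
  have hW0 : W 0 = LinearMap.range (LinearMap.mulLeft K (linClass F a b ^ (m + 1))) := by
    simp [W]
  have hWs : ∀ n, W (n + 1) =
      W n ⊔ Submodule.span K {linClass F a b ^ m * linClass F c e ^ n} := by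
    intro n
    have : Set.Iio (n + 1) = Set.Iio n ∪ {n} := by
      ext i
      simp only [Set.mem_Iio, Set.union_singleton, Set.mem_insert_iff]
      omega
    simp only [W]
    rw [this, Set.image_union, Set.image_singleton, Submodule.span_union, sup_assoc]
  have hmem : ∀ n, linClass F a b ^ m * linClass F c e ^ n ∈ W n ↔ ¬ IsStandard F a b c e n m := by
    intro n
    rw [IsStandard, not_not]
    refine ⟨fun hn => ?_, fun hn => Submodule.mem_sup_left hn⟩
    -- Projection to degree m + n kills the earlier generators, which have smaller degree, and
    -- preserves ℓ^(m+1) A.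
    have hle : W n ≤ (LinearMap.range (LinearMap.mulLeft K (linClass F a b ^ (m + 1)))).comap
        (gradedProj hF (m + n)) := by
      refine sup_le ?_ (Submodule.span_le.mpr ?_)
      · rintro _ ⟨x, rfl⟩
        rw [Submodule.mem_comap, LinearMap.mulLeft_apply,
          gradedProj_mul hF _ (linClass_pow_mem a b (m + 1))]
        split_ifs
        · exact ⟨_, rfl⟩
        · exact Submodule.zero_mem _
      · rintro _ ⟨u, hu, rfl⟩
        have hu' : u < n := hu
        rw [SetLike.mem_coe, Submodule.mem_comap,
          gradedProj_of_mem hF _ (linClass_pow_mul_pow_mem a b c e m u), if_neg (by omega)]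
        exact Submodule.zero_mem _
    have := hle hn
    rwa [Submodule.mem_comap, gradedProj_of_mem hF _ (linClass_pow_mul_pow_mem a b c e m n),
      if_pos rfl] at this
  have hcount : ∀ n, Module.finrank K (W n) = Module.finrank K (W 0) +
      ((Finset.range n).filter fun u => IsStandard F a b c e u m).card := by
    intro n
    induction n with
    | zero => simp
    | succ n ih =>
      rw [hWs, finrank_sup_span_singleton_eq (hmem n).symm, ih, Finset.range_add_one,
        Finset.filter_insert]
      split_ifs
      · rw [Finset.card_insert_of_notMem (by simp)]
        ring
      · rfl
  have hWN : LinearMap.range (LinearMap.mulLeft K (linClass F a b ^ m)) = W (j + 1) := by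
    apply le_antisymm
    · rintro _ ⟨x, rfl⟩
      have hx := Submodule.mem_map_of_mem (f := LinearMap.mulLeft K (linClass F a b ^ m))
        (exists_mem_range_sup_span hF h x)
      rwa [Submodule.map_sup, Submodule.map_span, Set.image_image, ← LinearMap.range_comp,
        ← LinearMap.mulLeft_mul, ← pow_succ] at hx
    · refine sup_le ?_ (Submodule.span_le.mpr ?_)
      · rintro _ ⟨x, rfl⟩
        exact ⟨linClass F a b * x, by simp only [LinearMap.mulLeft_apply]; ring⟩
      · rintro _ ⟨u, -, rfl⟩
        exact ⟨_, rfl⟩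
  rw [hWN, hcount, hW0]

theorem multBy_pow (a b : K) (m : ℕ) :
    multBy F (linForm a b) ^ m = LinearMap.mulLeft K (linClass F a b ^ m) :=
  LinearMap.pow_mulLeft K _ _ m

/-- The rows of the diagram are the parts of the Jordan type. -/
theorem lt_getD_iff_isStandard (hF : F.IsHomogeneous j) {a b c e : K} (h : a * e - b * c = 1)
    {P : List ℕ} (hP : IsJordanType (multBy F (linForm a b)) P) (u m : ℕ) :
    m < P.getD u 0 ↔ IsStandard F a b c e u m := by
  classical
  have := hP.finite
  have h1 := hP.finrank_range_pow m
  rw [multBy_pow, multBy_pow, finrank_range_mulLeft_pow hF h m, Nat.add_left_cancel_iff] at h1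
  -- Both conditions on u cut out initial segments of ℕ, which have the same cardinality.
  rw [← lt_card_filter_range_iff (p := fun u => m < P.getD u 0)
      (fun u v huv hv => hv.trans_le (hP.getD_antitone huv))
      (fun u hu => hP.getD_pos_iff.mp (by omega)) u, ← h1,
    lt_card_filter_range_iff (p := fun u => IsStandard F a b c e u m)
      (fun u v huv hv => hv.mono huv le_rfl) (fun u hu => hu.lt hF) u]

/-! ### Kernels of ℓ and Hessians -/

/-- If ℓ kills the class of f in A_u, then f ∘ F is a form of degree j - u killed by ℓ, hence
determined by the single scalar t^(j-u) f ∘ F. -/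
theorem finrank_ker_linClass_le_one [CharZero K] (hF : F.IsHomogeneous j) {a b c e : K}
    (h : a * e - b * c = 1) (u : ℕ) :
    Module.finrank K (LinearMap.ker ((LinearMap.mulLeft K (linClass F a b)).domRestrict
      (gradedPiece F u))) ≤ 1 := by
  let ψ : quotAlg F →ₗ[K] K :=
    lcoeff (R := K) 0 ∘ₗ quotAct F ∘ₗ LinearMap.mulLeft K (linClass F c e ^ (j - u))
  let ψ' := (ψ.domRestrict (gradedPiece F u)).domRestrict
    (LinearMap.ker ((LinearMap.mulLeft K (linClass F a b)).domRestrict (gradedPiece F u)))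
  have hinj : Function.Injective ψ' := by
    rw [injective_iff_map_eq_zero]
    rintro ⟨⟨x, hx⟩, hker⟩ hψ
    obtain ⟨f, hf, rfl⟩ := mem_gradedPiece.mp hx
    have hker' : Ideal.Quotient.mk (annF F) (linForm a b * f) = 0 := by
      rw [map_mul]
      exact hker
    have hψ' : coeff 0 (diffAct (linForm c e ^ (j - u) * f) F) = 0 := by
      rw [← quotAct_mk, map_mul, map_pow]
      exact hψ
    have hG := (diffAct_isHomogeneous hf hF).1
    rw [mk_eq_zero_iff, diffAct_mul, Module.End.mul_apply] at hker'
    rw [diffAct_mul, Module.End.mul_apply] at hψ'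
    have h0 := (diffAct_isHomogeneous (isHomogeneous_linForm_pow c e (j - u)) hG).1
    rw [Nat.sub_self] at h0
    obtain ⟨r, hr⟩ := isHomogeneous_zero_iff.mp h0
    rw [hr, coeff_zero_C] at hψ'
    rw [hψ', C_0] at hr
    have := eq_zero_of_diffAct_linForm_eq_zero h hG hker' hr
    simp only [Submodule.mk_eq_zero]
    exact mk_eq_zero_iff.mpr this
  simpa using LinearMap.finrank_le_finrank_of_injective hinj

theorem finrank_domRestrict_range_add_ker [Module.Finite K (quotAlg F)] (x : quotAlg F) (u : ℕ) :
    Module.finrank K ((gradedPiece F u).map (LinearMap.mulLeft K x)) +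
      Module.finrank K (LinearMap.ker ((LinearMap.mulLeft K x).domRestrict (gradedPiece F u))) =
        Module.finrank K (gradedPiece F u) := by
  rw [← LinearMap.range_domRestrict]
  exact LinearMap.finrank_range_add_finrank_ker _

/-- If t^(u+1) were outside ℓ A_u, then dim A_(u+1) = dim ℓ A_u + 1, which is at least dim A_u by
the bound on the kernel. -/
theorem not_isStandard_of_hilbertFn [CharZero K] [Module.Finite K (quotAlg F)]
    (hF : F.IsHomogeneous j) {a b c e : K} (h : a * e - b * c = 1) {u : ℕ}
    (hT : hilbertFn F (u + 1) < hilbertFn F u) : ¬ IsStandard F a b c e (u + 1) 0 := by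
  classical
  rw [not_isStandard_succ_iff hF, zero_add, pow_zero, one_mul, pow_one]
  by_contra hmem
  have h1 := finrank_ker_linClass_le_one hF h u
  have h2 := finrank_domRestrict_range_add_ker (linClass F a b) u
  have h3 := finrank_sup_span_singleton_eq (p := True)
    (W := (gradedPiece F u).map (LinearMap.mulLeft K (linClass F a b)))
    (v := linClass F c e ^ (u + 1)) (by simpa using hmem)
  rw [← gradedPiece_succ h, if_pos trivial] at h3
  unfold hilbertFn at hT
  omega

/-- The Hessian of order `i` does not vanish at `(a, b)` if and only if the multiplication by
`ℓ ^ (j - 2 i)` is injective on `A_i`. -/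
theorem hessAt_ne_zero_iff [CharZero K] (hF : F.IsHomogeneous j) {i : ℕ} (hi : 2 * i ≤ j)
    {ι : Type*} [Fintype ι] [DecidableEq ι] (α : Module.Basis ι K (gradedPiece F i)) (a b : K) :
    hessAt F i α a b ≠ 0 ↔
      ∀ x ∈ gradedPiece F i, linClass F a b ^ (j - 2 * i) * x = 0 → x = 0 := by
  have heval : ∀ x ∈ gradedPiece F i, ∀ y ∈ gradedPiece F i,
      (eval ![a, b] (quotAct F (x * y)) = 0 ↔
        quotAct F (linClass F a b ^ (j - 2 * i) * x * y) = 0) := by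
    intro x hx y hy
    obtain ⟨f, hf, rfl⟩ := mem_gradedPiece.mp hx
    obtain ⟨g, hg, rfl⟩ := mem_gradedPiece.mp hy
    rw [linClass, ← map_pow, mul_assoc, ← map_mul, ← map_mul, quotAct_mk, quotAct_mk,
      diffAct_mul (linForm a b ^ _), Module.End.mul_apply]
    have hG := (diffAct_isHomogeneous (hf.mul hg) hF).1
    rw [← two_mul] at hG
    -- The two values differ by the factor (j - 2i)!, nonzero in characteristic zero.
    rw [diffAct_linForm_pow a b hG, C_eq_zero, mul_eq_zero]
    simp [Nat.factorial_ne_zero]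
  -- The radical of the Gram form is the kernel of ℓ^(j-2i), since ℓ^(j-2i) x ∘ F has degree i and
  -- is tested by all forms of degree i.
  have hpair : ∀ x ∈ gradedPiece F i,
      (∀ y ∈ gradedPiece F i, eval ![a, b] (quotAct F (y * x)) = 0) ↔
        linClass F a b ^ (j - 2 * i) * x = 0 := by
    intro x hx
    constructor
    · intro hxy
      obtain ⟨f, hf, rfl⟩ := mem_gradedPiece.mp hx
      rw [linClass, ← map_pow, ← map_mul, mk_eq_zero_iff]
      have hG := (diffAct_isHomogeneous ((isHomogeneous_linForm_pow a b (j - 2 * i)).mul hf) hF).1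
      have hdeg : j - (j - 2 * i + i) = i := by omega
      rw [hdeg] at hG
      refine eq_zero_of_diffAct_eq_zero hG fun g hg => ?_
      have h1 := (heval _ hx _ (mk_mem_gradedPiece hg)).mp
        (by rw [mul_comm]; exact hxy _ (mk_mem_gradedPiece hg))
      rw [linClass, ← map_pow, mul_comm, ← map_mul, ← map_mul, quotAct_mk, diffAct_mul] at h1
      exact h1
    · intro h0 y hy
      rw [mul_comm, heval x hx y hy, h0, zero_mul, map_zero]
  have hdet : hessAt F i α a b = ((hessMatrix F i α).map (eval ![a, b])).det :=
    RingHom.map_det _ _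
  rw [hdet, ne_eq, ← Matrix.exists_mulVec_eq_zero_iff, not_exists]
  have hval : ∀ (v : ι → K) (y : quotAlg F),
      eval ![a, b] (quotAct F (y * (α.equivFun.symm v : quotAlg F))) =
        ∑ w, v w * eval ![a, b] (quotAct F (y * (α w : quotAlg F))) := by
    intro v y
    rw [Module.Basis.equivFun_symm_apply, AddSubmonoidClass.coe_finsetSum, Finset.mul_sum,
      map_sum, map_sum]
    refine Finset.sum_congr rfl fun w _ => ?_
    rw [Submodule.coe_smul, mul_smul_comm, map_smul, smul_eval]
  have hmulVec : ∀ (v : ι → K) (w : ι), ((hessMatrix F i α).map (eval ![a, b])).mulVec v w =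
      eval ![a, b] (quotAct F ((α w : quotAlg F) * (α.equivFun.symm v : quotAlg F))) := by
    intro v w
    rw [hval, Matrix.mulVec, dotProduct]
    exact Finset.sum_congr rfl fun w' _ => mul_comm _ _
  have hmul : ∀ v : ι → K, ((hessMatrix F i α).map (eval ![a, b])).mulVec v = 0 ↔
      linClass F a b ^ (j - 2 * i) * (α.equivFun.symm v : quotAlg F) = 0 := by
    intro v
    rw [← hpair _ (α.equivFun.symm v).2]
    constructor
    · intro hv y hy
      obtain ⟨v', hv'⟩ := α.equivFun.symm.surjective ⟨y, hy⟩
      have hy' : y = (α.equivFun.symm v' : quotAlg F) := congrArg Subtype.val hv'.symm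
      rw [hy', mul_comm, hval]
      refine Finset.sum_eq_zero fun w _ => ?_
      rw [mul_comm _ (α w : quotAlg F), ← hmulVec, hv, Pi.zero_apply, mul_zero]
    · intro hv
      funext w
      rw [hmulVec, hv _ (α w).2, Pi.zero_apply]
  constructor
  · intro h x hx h0
    by_contra hne
    refine h (α.equivFun ⟨x, hx⟩) ⟨?_, ?_⟩
    · simpa using hne
    · rw [hmul, LinearEquiv.symm_apply_apply]
      exact h0
  · rintro h v ⟨hv, h0⟩
    rw [hmul] at h0
    have := h _ (α.equivFun.symm v).2 h0
    simp only [ZeroMemClass.coe_eq_zero, LinearEquiv.map_eq_zero_iff] at this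
    exact hv this

/-- Injectivity on A_i means dim ℓ^(j-2i) A_i = i + 1, and this dimension counts the cells of rows
0, …, i on the diagonal j - i. -/
theorem hessAt_ne_zero_iff_isStandard [CharZero K] [Module.Finite K (quotAlg F)]
    (hF : F.IsHomogeneous j) {a b c e : K} (h : a * e - b * c = 1) {i : ℕ} (hi : 2 * i ≤ j)
    (α : Module.Basis (Fin (i + 1)) K (gradedPiece F i)) :
    hessAt F i α a b ≠ 0 ↔ ∀ u ≤ i, IsStandard F a b c e u (j - i - u) := by
  classical
  have hrank : Module.finrank K (gradedPiece F i) = i + 1 := by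
    simpa using Module.finrank_eq_card_basis α
  have h1 := finrank_domRestrict_range_add_ker (linClass F a b ^ (j - 2 * i)) i
  have hdeg : j - 2 * i + i = j - i := by omega
  rw [finrank_map_gradedPiece hF h, hrank, hdeg] at h1
  have h2 : (∀ u ≤ i, IsStandard F a b c e u (j - i - u)) ↔ ((Finset.range (i + 1)).filter
      fun u => IsStandard F a b c e u (j - i - u)).card = (Finset.range (i + 1)).card := by
    rw [Finset.card_filter_eq_iff]
    simp only [Finset.mem_range, Nat.lt_succ_iff]
  rw [h2, Finset.card_range, hessAt_ne_zero_iff hF hi]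
  have h3 : (∀ x ∈ gradedPiece F i, linClass F a b ^ (j - 2 * i) * x = 0 → x = 0) ↔
      Module.finrank K (LinearMap.ker
        ((LinearMap.mulLeft K (linClass F a b ^ (j - 2 * i))).domRestrict
        (gradedPiece F i))) = 0 := by
    rw [Submodule.finrank_eq_zero, LinearMap.ker_eq_bot']
    simp [Subtype.forall]
  rw [h3]
  omega

end Quotient

end CIJordan

end

/-! ### The main theorem -/

theorem theorem3p4 {K : Type*} [Field K] [CharZero K]
    (d k j : ℕ) (hd : 1 ≤ d) (hk : 1 ≤ k) (hj : j + 3 = 2 * d + k)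
    (F : MvPolynomial (Fin 2) K) (hF : F.IsHomogeneous j)
    (hT : ∀ u : ℕ, CIJordan.hilbertFn F u = CIJordan.ciSeq d k u)
    (a b : K) (hab : a ≠ 0 ∨ b ≠ 0)
    (P : List ℕ)
    (hP : CIJordan.IsJordanType (CIJordan.multBy F (CIJordan.linForm a b)) P) :
    (∀ i : ℕ, i ≤ d - 1 →
      ∀ α : Module.Basis (Fin (i + 1)) K (CIJordan.gradedPiece F i),
        CIJordan.hessAt F i α a b ≠ 0 ↔ (P.take (i + 1)).sum = (i + 1) * (j + 1 - i)) ∧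
    (∀ α : Module.Basis (Fin d) K (CIJordan.gradedPiece F (d - 1)),
      P.length = d ↔ ¬ (2 ≤ k ∧ CIJordan.hessAt F (d - 1) α a b = 0)) := by
  classical
  obtain ⟨c, e, h⟩ := CIJordan.exists_complementary hab
  have hfin := hP.finite
  have hq := CIJordan.lt_getD_iff_isStandard hF h hP
  have hanti : ∀ u v, u ≤ v → P.getD v 0 ≤ P.getD u 0 := fun u v huv => hP.getD_antitone huv
  have hdiag : ∀ v, ((Finset.range (v + 1)).filter fun u => v - u < P.getD u 0).card =
      CIJordan.ciSeq d k v := by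
    intro v
    have h1 := CIJordan.finrank_map_gradedPiece hF h v 0
    rw [pow_zero, LinearMap.mulLeft_one, Submodule.map_id] at h1
    rw [← hT, CIJordan.hilbertFn, h1]
    simp only [hq, zero_add]
  -- In degrees v from j + 2 - d = d + k - 1 to j one has T(v) < T(v - 1), so t^v ∈ ℓ A; for v > j
  -- already t^v = 0.
  have hzero : ∀ v, j + 2 ≤ v + d → P.getD v 0 = 0 := by
    intro v hv
    by_contra hpos
    have hstd := (hq v 0).mp (Nat.pos_of_ne_zero hpos)
    have hvj := hstd.lt hF
    obtain ⟨u, rfl⟩ := Nat.exists_eq_succ_of_ne_zero (show v ≠ 0 by omega)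
    refine CIJordan.not_isStandard_of_hilbertFn hF h ?_ hstd
    rw [hT, hT]
    unfold CIJordan.ciSeq
    omega
  constructor
  · intro i hi α
    rw [CIJordan.hessAt_ne_zero_iff_isStandard hF h (by omega) α, CIJordan.sum_take_eq_sum_getD,
      ← CIJordan.forall_lt_iff_sum_eq hd hk hj hdiag hzero hi]
    simp only [hq]
  · intro α
    obtain ⟨d, rfl⟩ := Nat.exists_eq_succ_of_ne_zero (show d ≠ 0 by omega)
    have hrow := CIJordan.forall_lt_iff_row_eq_zero hd hk hj hdiag hanti hzero
    have hess := CIJordan.hessAt_ne_zero_iff_isStandard hF h (i := d) (by omega) α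
    have hlen : P.length = d + 1 ↔ P.getD (d + 1) 0 = 0 := by
      -- With d now standing for the old d - 1, row d is nonempty because the diagonal d carries d +
      -- 1 cells, one in each of the rows 0, …, d.
      have h1 := hP.getD_pos_iff (u := d)
      have h2 := hP.getD_pos_iff (u := d + 1)
      have h3 : 0 < P.getD d 0 := by
        have hfull := Finset.card_filter_eq_iff.mp ((hdiag d).trans
          (show CIJordan.ciSeq (d + 1) k d = (Finset.range (d + 1)).card by
            rw [Finset.card_range]
            unfold CIJordan.ciSeq
            omega))
        simpa using hfull d (by simp)
      omega
    have hmain : P.length = d + 1 ↔ CIJordan.hessAt F d α a b ≠ 0 := by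
      rw [hlen, hess, ← hrow]
      simp only [hq, Nat.succ_sub_one]
    refine hmain.trans ⟨fun h0 h1 => h0 h1.2, fun h0 h1 => ?_⟩
    -- For k = 1 the row below is always empty, so the Hessian cannot vanish; hence the exception
    -- only concerns k ≥ 2.
    rcases hk.eq_or_lt with rfl | hk1
    · exact hmain.mp (hlen.mpr (hzero _ (by omega))) h1
    · exact h0 ⟨hk1, h1⟩
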